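/- Let $\lambda>0$, let $n\ge 2$, and let $N^1,\dots,N^n$ be independent Poisson processes with intensity $\lambda$ on a common probability space. Define the multiply iterated Poisson processes by $V^{(1)}_t=N^1_t$ and $V^{(m)}_t=N^m_{V^{(m-1)}_t}$ for $2\le m\le n$, and put $q_j=P(V^{(j)}_1>0)$ for $1\le j\le n$. Define the jump times of $V^{(n)}$ by $$J_0=0,\qquad J_{k+1}=\inf\{t\ge J_k : V^{(n)}_t\ne V^{(n)}_{J_k}\}\quad(k\ge 0),\qquad \inf\emptyset=\infty,$$ and its sojourn times, for $k\ge 1$, by $S_k=J_k-J_{k-1}$ if $J_{k-1}<\infty$ and $S_k=\infty$ otherwise. Then the sojourn times $S_1,S_2,\dots$ are almost surely finite, independent and identically distributed exponential random variables, $$S_k\sim \mathrm{Exp}(\lambda q_{n-1})\qquad\text{for all }k\ge 1,$$ where $\lambda q_{n-1}$ is the rate. Moreover, $q_1=1-e^{-\lambda}$ and $q_j=1-e^{-\lambda q_{j-1}}$ for $2\le j\le n$. (Since $n\ge 2$ is arbitrary, the recursion holds for every $j\ge 2$.) -/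

import Mathlib

open MeasureTheory ProbabilityTheory
open scoped NNReal ENNReal

/-- `N` is a (homogeneous) Poisson process with intensity `lam` under `P`: an integer-valued
process started at `0`, with almost surely nondecreasing right-continuous sample paths, with
independent increments, and with `N t - N s` Poisson distributed with mean `lam * (t - s)`
for `s ≤ t`. Since paths are nondecreasing, subtraction in `ℕ` is the true increment. -/
structure IsPoissonProcess {Ω : Type*} [MeasurableSpace Ω] (N : ℝ≥0 → Ω → ℕ) (lam : ℝ≥0)
    (P : Measure Ω) : Prop where
  measurable : ∀ t, Measurable (N t)
  start_zero : ∀ᵐ ω ∂P, N 0 ω = 0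
  monotone_path : ∀ᵐ ω ∂P, Monotone fun t => N t ω
  right_continuous : ∀ᵐ ω ∂P, ∀ t : ℝ≥0, ContinuousWithinAt (fun s => N s ω) (Set.Ici t) t
  indep_increments : HasIndepIncrements N P
  law_increment : ∀ s t : ℝ≥0, s ≤ t →
    HasLaw (fun ω => N t ω - N s ω) (poissonMeasure (lam * (t - s))) P

/-- The multiply iterated process `V^(m)` built from `N 1, N 2, …`:
`V^(1)_t = N^1_t` and `V^(m+1)_t = N^(m+1)` evaluated at time `V^(m)_t`, for `m ≥ 1`.
(The value at `m = 0` is a placeholder without meaning.) -/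
def iteratedProcess {Ω : Type*} (N : ℕ → ℝ≥0 → Ω → ℕ) : ℕ → ℝ≥0 → Ω → ℕ
  | 0 => fun _ _ => 0
  | 1 => N 1
  | (m + 2) => fun t ω => N (m + 2) (iteratedProcess N (m + 1) t ω : ℝ≥0) ω

/-- Jump times of a path `v`: `J_0 = 0` and `J_{k+1} = inf {t ≥ J_k : v t ≠ v (J_k)}`, with
`inf ∅ = ∞`. (When `J_k = ∞` there is no `t ≥ J_k` in `ℝ≥0`, so `J_{k+1} = ∞`.) -/
noncomputable def jumpTime (v : ℝ≥0 → ℕ) : ℕ → ℝ≥0∞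
  | 0 => 0
  | (k + 1) => sInf {s : ℝ≥0∞ | ∃ t : ℝ≥0, s = (t : ℝ≥0∞) ∧ jumpTime v k ≤ (t : ℝ≥0∞) ∧
      v t ≠ v (jumpTime v k).toNNReal}

open Classical in
/-- Sojourn times of a path, for `k ≥ 1`: `S_k = J_k - J_{k-1}` if `J_{k-1} < ∞`, and `∞`
otherwise. -/
noncomputable def sojournTime (v : ℝ≥0 → ℕ) (k : ℕ) : ℝ≥0∞ :=
  if jumpTime v (k - 1) < ∞ then jumpTime v k - jumpTime v (k - 1) else ∞

/-- `q_j = P(V^(j)_1 > 0)`. -/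
noncomputable def positiveProb {Ω : Type*} [MeasurableSpace Ω] (P : Measure Ω)
    (N : ℕ → ℝ≥0 → Ω → ℕ) (j : ℕ) : ℝ :=
  P.real {ω | 0 < iteratedProcess N j 1 ω}

/-!
The iterated process `V^(n)` is a subordinator: evaluating the Poisson process `N^(m+1)` along an
independent nondecreasing integer-valued process with independent increments yields again such a
process, because, given the inner process, the increments of the outer one are independent Poisson
variables with means proportional to the inner increments (`lintegral_prod_increments_comp`,
`IsStepSubordinator.comp_poisson`). If the inner increments over `[s, t]` have generating function
`z ↦ exp (-(g z * (t - s)))`, the outer ones have the same with `g ∘ ψ` in place of `g`, where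
`ψ z = exp (-(lam * (1 - z)))`. Hence the exponent of `V^(m)` is `z ↦ lam * (1 - ψ^[m - 1] z)`.
At `z = 0` this gives `q_m = 1 - ψ^[m] 0`, which is the recursion for `q`, and it shows that
`V^(n)` does not jump during an interval of length `s` with probability
`exp (-(lam * q_{n-1} * s))`.

It remains to see that, for a right-continuous nondecreasing integer-valued process with independent
increments and this no-jump probability, the sojourn times are independent and exponential
(`IsRegularJumpProcess.iIndepFun_sojournTime`, `IsRegularJumpProcess.hasLaw_sojournTime`). The event
that the sojourn after `J_k` is longer than `s` is `V (J_k + s) = V J_k`. Approximating `J_k` from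
above by times on a grid reduces its conditional probability, given `J_1, …, J_k`, to the one at a
deterministic time (`measure_inter_eval_add_eq`). That the past is known at a deterministic time
`t` follows from the fact that the jump times before `t` are those of the path stopped at `t`
(`jumpTime_congr_of_lt`). To have measurable jump times, the process is first changed on a null set
so that all its paths are regular (`exists_isRegularJumpProcess`).
-/

/-! ### Right-continuous integer-valued paths and their jump times -/

/-- A step path: a nondecreasing right-continuous path `v : ℝ≥0 → ℕ`. For nondecreasing
integer-valued paths, right-continuity means that each value persists for a positive time. No
starting value is prescribed. -/
structure IsStepPath (v : ℝ≥0 → ℕ) : Prop where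
  mono : Monotone v
  persist : ∀ t, ∃ u, t < u ∧ v u = v t

theorem IsStepPath.eq_of_mem_Icc {v : ℝ≥0 → ℕ} (hv : IsStepPath v) {s t r : ℝ≥0}
    (h : v s = v t) (hs : s ≤ r) (ht : r ≤ t) : v r = v s :=
  le_antisymm ((hv.mono ht).trans h.ge) (hv.mono hs)

theorem IsStepPath.of_rightContinuous {v : ℝ≥0 → ℕ} (hv : Monotone v)
    (hc : ∀ t, ContinuousWithinAt v (Set.Ici t) t) : IsStepPath v := by
  refine ⟨hv, fun t => ?_⟩
  have h1 : ∀ᶠ s in nhdsWithin t (Set.Ici t), v s = v t := by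
    have := hc t
    rw [ContinuousWithinAt, nhds_discrete, Filter.tendsto_pure] at this
    exact this
  have h2 : ∀ᶠ s in nhdsWithin t (Set.Ioi t), v s = v t :=
    h1.filter_mono (nhdsWithin_mono _ Set.Ioi_subset_Ici_self)
  obtain ⟨u, hu, htu⟩ := (h2.and self_mem_nhdsWithin).exists
  exact ⟨u, htu, hu⟩

theorem isStepPath_zero : IsStepPath fun _ => 0 :=
  ⟨monotone_const, fun t => ⟨t + 1, lt_add_one t, rfl⟩⟩

/-- Evaluating a right-continuous nondecreasing path along a step path gives a step path: the inner
path takes integer values, so it is constant to the right of every time. -/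
theorem IsStepPath.comp {v w : ℝ≥0 → ℕ} (hv : IsStepPath v) (hw : Monotone w) :
    IsStepPath fun t => w (v t) := by
  refine ⟨fun s t h => hw (Nat.cast_le.2 (hv.mono h)), fun t => ?_⟩
  obtain ⟨u, hu, h⟩ := hv.persist t
  exact ⟨u, hu, by simp only [h]⟩

theorem IsStepPath.stopped {v : ℝ≥0 → ℕ} (hv : IsStepPath v) (t : ℝ≥0) :
    IsStepPath fun r => v (min r t) := by
  refine ⟨fun a b h => hv.mono (min_le_min_right t h), fun r => ?_⟩
  obtain ⟨u, hu, h⟩ := hv.persist (min r t)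
  rcases lt_or_ge r t with hr | hr
  · rw [min_eq_left hr.le] at hu h
    exact ⟨u, hu, by
      rw [min_eq_left hr.le]
      exact hv.eq_of_mem_Icc h.symm (le_min hu.le hr.le) (min_le_left _ _)⟩
  · exact ⟨r + 1, lt_add_one r, by rw [min_eq_right hr, min_eq_right (hr.trans (by simp))]⟩

theorem jumpTime_succ_lt_iff {v : ℝ≥0 → ℕ} {k : ℕ} {s : ℝ≥0∞} :
    jumpTime v (k + 1) < s ↔ ∃ t : ℝ≥0, (t : ℝ≥0∞) < s ∧ jumpTime v k ≤ t ∧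
      v t ≠ v (jumpTime v k).toNNReal := by
  rw [jumpTime, sInf_lt_iff]
  constructor
  · rintro ⟨_, ⟨t, rfl, h1, h2⟩, h3⟩
    exact ⟨t, h3, h1, h2⟩
  · rintro ⟨t, h3, h1, h2⟩
    exact ⟨_, ⟨t, rfl, h1, h2⟩, h3⟩

theorem jumpTime_le_succ (v : ℝ≥0 → ℕ) (k : ℕ) : jumpTime v k ≤ jumpTime v (k + 1) := by
  by_contra! h
  obtain ⟨t, ht, h1, -⟩ := jumpTime_succ_lt_iff.1 h
  exact absurd h1 ht.not_ge

theorem jumpTime_mono (v : ℝ≥0 → ℕ) : Monotone (jumpTime v) :=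
  monotone_nat_of_le_succ (jumpTime_le_succ v)

/-- The path is still at `v J_k` at time `J_k + s` iff the next jump comes strictly later; strictness
is right-continuity at `J_k + s`. -/
theorem lt_jumpTime_succ_iff {v : ℝ≥0 → ℕ} (hv : IsStepPath v) {k : ℕ} {r : ℝ≥0}
    (hr : jumpTime v k = r) (s : ℝ≥0) :
    ((r + s : ℝ≥0) : ℝ≥0∞) < jumpTime v (k + 1) ↔ v (r + s) = v r := by
  constructor
  · intro h
    by_contra hne
    have : jumpTime v (k + 1) ≤ ((r + s : ℝ≥0) : ℝ≥0∞) := by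
      refine sInf_le ⟨r + s, rfl, ?_, ?_⟩
      · rw [hr]; simp
      · simpa [hr] using hne
    exact absurd h this.not_gt
  · intro h
    obtain ⟨u, hu, huv⟩ := hv.persist (r + s)
    refine lt_of_lt_of_le (ENNReal.coe_lt_coe.2 hu) ?_
    by_contra! hlt
    obtain ⟨t, ht, h1, h2⟩ := jumpTime_succ_lt_iff.1 hlt
    rw [hr, ENNReal.coe_le_coe] at h1
    rw [hr, ENNReal.toNNReal_coe] at h2
    exact h2 (hv.eq_of_mem_Icc (h.symm.trans huv.symm) h1 (ENNReal.coe_lt_coe.1 ht).le)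

/-- The jump times before `t` only depend on the path before `t`. -/
theorem jumpTime_congr_of_lt {v w : ℝ≥0 → ℕ} {t : ℝ≥0∞} (h : ∀ r : ℝ≥0, (r : ℝ≥0∞) < t → v r = w r)
    {k : ℕ} (hk : jumpTime v k < t) : jumpTime w k = jumpTime v k := by
  induction k with
  | zero => rfl
  | succ k ih =>
    have hk' := (jumpTime_le_succ v k).trans_lt hk
    have hJ := ih hk'
    have hval : v (jumpTime v k).toNNReal = w (jumpTime v k).toNNReal :=
      h _ (by rwa [ENNReal.coe_toNNReal (hk'.ne_top)])
    have key : ∀ s ≤ t, jumpTime w (k + 1) < s ↔ jumpTime v (k + 1) < s := by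
      intro s hs
      rw [jumpTime_succ_lt_iff, jumpTime_succ_lt_iff, hJ, ← hval]
      refine exists_congr fun r => and_congr_right fun hr => ?_
      rw [h r (hr.trans_le hs)]
    refine le_antisymm (le_of_forall_gt fun s hs => ?_) ?_
    · exact ((key _ (min_le_right s t)).2 (lt_min hs hk)).trans_le (min_le_left _ _)
    · by_contra! hlt
      exact absurd ((key _ hk.le).1 hlt) (lt_irrefl _)

section Measurability

variable {Ω : Type*} [MeasurableSpace Ω] {X : ℝ≥0 → Ω → ℕ}

theorem measurable_eval_of_isStepPath (hX : ∀ t, Measurable (X t))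
    (hs : ∀ ω, IsStepPath fun t => X t ω) {τ : Ω → ℝ≥0} (hτ : Measurable τ) :
    Measurable fun ω => X (τ ω) ω := by
  obtain ⟨D, hDc, hDd⟩ := TopologicalSpace.exists_countable_dense ℝ≥0
  refine measurable_of_Iic fun n => ?_
  have : (fun ω => X (τ ω) ω) ⁻¹' Set.Iic n = ⋃ q ∈ D, {ω | τ ω < q} ∩ {ω | X q ω ≤ n} := by
    ext ω
    simp only [Set.mem_preimage, Set.mem_Iic, Set.mem_iUnion, Set.mem_inter_iff, Set.mem_ofPred_eq,
      exists_prop]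
    constructor
    · intro h
      obtain ⟨u, hu, huv⟩ := (hs ω).persist (τ ω)
      obtain ⟨q, hq, h1, h2⟩ := hDd.exists_between hu
      exact ⟨q, hq, h1, ((hs ω).mono h2.le).trans (huv.le.trans h)⟩
    · rintro ⟨q, -, h1, h2⟩
      exact ((hs ω).mono h1.le).trans h2
  rw [this]
  refine MeasurableSet.biUnion hDc fun q _ => ?_
  exact (measurableSet_lt hτ measurable_const).inter (hX q measurableSet_Iic)

theorem measurable_jumpTime (hX : ∀ t, Measurable (X t))
    (hs : ∀ ω, IsStepPath fun t => X t ω) (k : ℕ) :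
    Measurable fun ω => jumpTime (fun t => X t ω) k := by
  induction k with
  | zero => exact measurable_const
  | succ k ih =>
    obtain ⟨D, hDc, hDd⟩ := TopologicalSpace.exists_countable_dense ℝ≥0
    refine measurable_of_Iio fun s => ?_
    have hev := measurable_eval_of_isStepPath hX hs ih.ennreal_toNNReal
    have : (fun ω => jumpTime (fun t => X t ω) (k + 1)) ⁻¹' Set.Iio s =
        ⋃ q ∈ D, {ω | (q : ℝ≥0∞) < s} ∩ ({ω | jumpTime (fun t => X t ω) k ≤ q} ∩
          {ω | X q ω = X (jumpTime (fun t => X t ω) k).toNNReal ω}ᶜ) := by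
      ext ω
      simp only [Set.mem_preimage, Set.mem_Iio, jumpTime_succ_lt_iff, Set.mem_iUnion,
        Set.mem_inter_iff, Set.mem_ofPred_eq, Set.mem_compl_iff, exists_prop]
      constructor
      · rintro ⟨t, h1, h2, h3⟩
        obtain ⟨u, hu, huv⟩ := (hs ω).persist t
        have : ∃ u', t < u' ∧ (u' : ℝ≥0∞) ≤ s ∧ u' ≤ u := by
          obtain ⟨u', h, h'⟩ := ENNReal.lt_iff_exists_nnreal_btwn.1 h1
          exact ⟨min u u', lt_min hu (ENNReal.coe_lt_coe.1 h),
            (ENNReal.coe_le_coe.2 (min_le_right _ _)).trans h'.le, min_le_left _ _⟩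
        obtain ⟨u', h4, h5, h6⟩ := this
        obtain ⟨q, hq, h7, h8⟩ := hDd.exists_between h4
        refine ⟨q, hq, (ENNReal.coe_lt_coe.2 h8).trans_le h5,
          h2.trans (ENNReal.coe_le_coe.2 h7.le), ?_⟩
        have hq' : X q ω = X t ω := (hs ω).eq_of_mem_Icc huv.symm h7.le (h8.le.trans h6)
        rwa [hq']
      · rintro ⟨q, -, h1, h2, h3⟩
        exact ⟨q, h1, h2, h3⟩
    rw [this]
    refine MeasurableSet.biUnion hDc fun q _ => (MeasurableSet.const _).inter
      ((measurableSet_le ih measurable_const).inter ?_)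
    exact (measurableSet_eq_fun (hX q) hev).compl

end Measurability

/-! ### Independence of past and future -/

/-- A sequence of random elements, each independent of the vector of its predecessors, is
independent. -/
theorem iIndepFun_of_indepFun_past {Ω β : Type*} [MeasurableSpace Ω] [MeasurableSpace β]
    {P : Measure Ω} [IsProbabilityMeasure P] {f : ℕ → Ω → β}
    (h : ∀ k, IndepFun (fun ω (i : Set.Iio k) => f i ω) (f k) P) : iIndepFun f P := by
  rw [iIndepFun_iff_measure_inter_preimage_eq_mul]
  intro S sets hS
  induction S using Finset.induction_on_max with
  | empty => simp
  | insert a S ha ih =>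
    have haS : a ∉ S := fun h => lt_irrefl _ (ha a h)
    rw [Finset.set_biInter_insert, Finset.prod_insert haS,
      ← ih fun i hi => hS i (Finset.mem_insert_of_mem hi), Set.inter_comm, mul_comm]
    have hpre : (⋂ i ∈ S, f i ⁻¹' sets i) = (fun ω (i : Set.Iio a) => f i ω) ⁻¹'
        (⋂ i : Set.Iio a, ⋂ (_ : (i : ℕ) ∈ S), (fun x => x i) ⁻¹' sets i) := by
      ext ω
      simp only [Set.mem_iInter, Set.mem_preimage, Subtype.forall]
      exact ⟨fun H i _ hi => H i hi, fun H i hi => H i (ha i hi) hi⟩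
    rw [hpre]
    refine (h a).measure_inter_preimage_eq_mul _ _ ?_ (hS a (Finset.mem_insert_self _ _))
    refine MeasurableSet.iInter fun i => MeasurableSet.iInter fun hi => ?_
    exact measurable_pi_apply i (hS i (Finset.mem_insert_of_mem hi))

/-- The process stopped at a deterministic time `t` is independent of a later increment. -/
theorem indepFun_stopped_increment {Ω : Type*} [MeasurableSpace Ω] {P : Measure Ω}
    [IsProbabilityMeasure P] {X : ℝ≥0 → Ω → ℕ} (hX : ∀ t, Measurable (X t))
    (h0 : ∀ ω, X 0 ω = 0) (hmono : ∀ ω, Monotone fun t => X t ω) (hind : HasIndepIncrements X P)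
    (t s : ℝ≥0) :
    IndepFun (fun ω (r : ℝ≥0) => X (min r t) ω) (fun ω => X (t + s) ω - X t ω) P := by
  refine IndepFun.process_indepFun (fun r => hX _) ((hX _).sub (hX _)) fun I => ?_
  -- `J` is the finite set of times involved; it is enumerated increasingly up to `t`.
  let J : Finset ℝ≥0 := insert 0 (insert t (I.image fun r => min r t))
  let e := J.orderEmbOfFin rfl
  have hsurj : ∀ x ∈ J, ∃ i, e i = x := fun x hx => by
    have : x ∈ Set.range e := by rw [Finset.range_orderEmbOfFin]; exact hx
    exact this
  obtain ⟨m, hm⟩ := hsurj t (by simp [J])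
  obtain ⟨z, hz⟩ := hsurj 0 (by simp [J])
  have hJpos : 0 < J.card := m.pos
  have hz0 : e ⟨0, hJpos⟩ = 0 := le_antisymm (by
    rw [← hz]; exact e.monotone (Fin.mk_le_of_le_val (Nat.zero_le _))) zero_le
  let τ : ℕ → ℝ≥0 := fun i => if h : i ≤ m then e ⟨i, h.trans_lt m.2⟩ else t + s
  have hτ : Monotone τ := by
    intro i j hij
    by_cases hj : j ≤ m
    · simp only [τ, hj, hij.trans hj, dite_true]
      exact e.monotone hij
    · by_cases hi : i ≤ m
      · simp only [τ, hi, hj, dite_true, dite_false]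
        refine le_trans ?_ (le_self_add : t ≤ t + s)
        rw [← hm]
        exact e.monotone hi
      · simp [τ, hi, hj]
  have hτ0 : τ 0 = 0 := by simpa [τ] using hz0
  have hτm : τ m = t := by simpa [τ] using hm
  have hτm1 : τ (m + 1) = t + s := by simp [τ]
  have htel : ∀ i ω, X (τ i) ω = ∑ l ∈ Finset.range i, (X (τ (l + 1)) ω - X (τ l) ω) := by
    intro i ω
    induction i with
    | zero => simp [hτ0, h0]
    | succ i ih =>
      rw [Finset.sum_range_succ, ← ih]
      have := hmono ω (hτ (Nat.le_succ i))
      simp only [Nat.succ_eq_add_one] at this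
      omega
  have hfin := (hind.nat hτ).indepFun_finset (Finset.range m) {(m : ℕ)} (by simp)
    fun i => (hX _).sub (hX _)
  have hidx : ∀ r : I, ∃ i : ℕ, i ≤ m ∧ τ i = min (r : ℝ≥0) t := by
    intro r
    obtain ⟨i, hi⟩ := hsurj (min (r : ℝ≥0) t) (by
      simp only [J, Finset.mem_insert, Finset.mem_image]
      exact Or.inr (Or.inr ⟨r, r.2, rfl⟩))
    have him : i ≤ m := by
      rw [← e.le_iff_le, hi, hm]
      exact min_le_right _ _
    exact ⟨i, him, by simpa [τ, Fin.le_def.1 him] using hi⟩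
  choose idx hidx hτidx using hidx
  have hφ : Measurable fun (x : Finset.range (m : ℕ) → ℕ) (r : I) =>
      ∑ l : Finset.range (m : ℕ), if (l : ℕ) < idx r then x l else 0 := by
    refine measurable_pi_lambda _ fun r => Finset.measurable_sum _ fun l _ => ?_
    split_ifs
    · exact measurable_pi_apply l
    · exact measurable_const
  have hψ : Measurable fun x : ({(m : ℕ)} : Finset ℕ) → ℕ => x ⟨m, by simp⟩ :=
    measurable_pi_apply _
  convert! hfin.comp hφ hψ using 1
  · funext ω r
    simp only [Function.comp]
    rw [← hτidx, htel, Finset.sum_coe_sort (Finset.range (m : ℕ)) fun l =>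
      if l < idx r then X (τ (l + 1)) ω - X (τ l) ω else 0, ← Finset.sum_filter]
    refine Finset.sum_congr ?_ fun _ _ => rfl
    ext l
    have := hidx r
    simp only [Finset.mem_range, Finset.mem_filter]
    omega
  · funext ω
    simp [Function.comp, hτm, hτm1]

/-- A strong Markov property in its simplest form. If, for every deterministic time `t`, the event
of no change on `[t, t + s]` has probability `c` and is independent of the past `F t`, then the same
holds at a random time `τ`, for events `A` of the past of `τ`. The proof approximates `τ` from above
by times with values in a grid; the event `A` needs no approximation. -/
theorem measure_inter_eval_add_eq {Ω : Type*} {mΩ : MeasurableSpace Ω} {P : Measure Ω}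
    [IsProbabilityMeasure P] {X : ℝ≥0 → Ω → ℕ} (hX : ∀ t, Measurable (X t))
    (hs : ∀ ω, IsStepPath fun t => X t ω) {F : ℝ≥0 → MeasurableSpace Ω} (hF : Monotone F)
    (hFle : ∀ t, F t ≤ mΩ) {s : ℝ≥0} {c : ℝ≥0∞}
    (hc : ∀ t E, MeasurableSet[F t] E → P (E ∩ {ω | X (t + s) ω = X t ω}) = P E * c)
    {τ : Ω → ℝ≥0} (hτ : Measurable τ) {A : Set Ω}
    (hA : ∀ t, MeasurableSet[F t] (A ∩ {ω | τ ω < t})) :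
    P (A ∩ {ω | X (τ ω + s) ω = X (τ ω) ω}) = P A * c := by
  have hAmeas : MeasurableSet A := by
    have : A = ⋃ n : ℕ, A ∩ {ω | τ ω < n} := by
      rw [← Set.inter_iUnion, Set.left_eq_inter]
      intro ω _
      obtain ⟨n, hn⟩ := exists_nat_gt (τ ω)
      exact Set.mem_iUnion.2 ⟨n, hn⟩
    rw [this]
    exact MeasurableSet.iUnion fun n => hFle _ _ (hA n)
  let fl : ℕ → Ω → ℕ := fun m ω => ⌊(m + 1 : ℝ≥0) * τ ω⌋₊
  let T : ℕ → Ω → ℝ≥0 := fun m ω => (fl m ω + 1 : ℝ≥0) / (m + 1)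
  have hfl : ∀ m, Measurable (fl m) := fun m => Nat.measurable_floor.comp (hτ.const_mul _)
  have hT : ∀ m, Measurable (T m) := fun m =>
    ((measurable_from_top (f := fun n : ℕ => (n + 1 : ℝ≥0) / (m + 1))).comp (hfl m))
  have hmpos : ∀ m : ℕ, (0 : ℝ≥0) < m + 1 := fun m => by positivity
  have hTgt : ∀ m ω, τ ω < T m ω := fun m ω => by
    rw [lt_div_iff₀ (hmpos m), mul_comm]
    exact Nat.lt_floor_add_one _
  have hTle : ∀ m ω, T m ω ≤ τ ω + 1 / (m + 1) := fun m ω => by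
    rw [div_le_iff₀ (hmpos m), add_mul, div_mul_cancel₀ _ (hmpos m).ne', mul_comm (τ ω)]
    gcongr
    exact Nat.floor_le zero_le
  -- On the grid, the statement is the hypothesis `hc` summed over the values of `T m`.
  have hgrid : ∀ m, P (A ∩ {ω | X (T m ω + s) ω = X (T m ω) ω}) = P A * c := by
    intro m
    let t : ℕ → ℝ≥0 := fun j => (j + 1 : ℝ≥0) / (m + 1)
    let E : ℕ → Set Ω := fun j => A ∩ fl m ⁻¹' {j}
    have hdisj : Pairwise (Function.onFun Disjoint E) := fun i j hij =>
      Set.disjoint_left.2 fun ω h1 h2 => hij (h1.2.symm.trans h2.2)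
    have hEF : ∀ j, MeasurableSet[F (t j)] (E j) := by
      intro j
      have hE : E j = (A ∩ {ω | τ ω < t j}) \ (A ∩ {ω | τ ω < (j : ℝ≥0) / (m + 1)}) := by
        ext ω
        simp only [E, fl, t, Set.mem_inter_iff, Set.mem_preimage, Set.mem_singleton_iff,
          Set.mem_sdiff, Set.mem_ofPred_eq, lt_div_iff₀ (hmpos m), mul_comm (τ ω), not_and, not_lt,
          Nat.floor_eq_iff (zero_le : 0 ≤ (m + 1 : ℝ≥0) * τ ω)]
        tauto
      rw [hE]
      refine MeasurableSet.diff (hA _) (hF ?_ _ (hA _))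
      simp only [t]
      gcongr
      simp
    have hEm : ∀ j, MeasurableSet (E j) := fun j => hFle _ _ (hEF j)
    have hG : ∀ j, MeasurableSet {ω | X (t j + s) ω = X (t j) ω} := fun j =>
      measurableSet_eq_fun (hX _) (hX _)
    have h1 : A ∩ {ω | X (T m ω + s) ω = X (T m ω) ω} =
        ⋃ j, E j ∩ {ω | X (t j + s) ω = X (t j) ω} := by
      ext ω
      simp only [E, T, t, Set.mem_inter_iff, Set.mem_iUnion, Set.mem_preimage,
        Set.mem_singleton_iff, Set.mem_ofPred_eq]
      constructor
      · rintro ⟨ha, h⟩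
        exact ⟨fl m ω, ⟨ha, rfl⟩, h⟩
      · rintro ⟨j, ⟨ha, rfl⟩, h⟩
        exact ⟨ha, h⟩
    have h2 : A = ⋃ j, E j := by
      ext ω
      simp [E]
    rw [h1, measure_iUnion (fun i j hij => (hdisj hij).mono Set.inter_subset_left
      Set.inter_subset_left) fun j => (hEm j).inter (hG j)]
    conv_rhs => rw [h2, measure_iUnion hdisj hEm]
    rw [← ENNReal.tsum_mul_right]
    exact tsum_congr fun j => hc _ _ (hEF j)
  have hlim : Filter.Tendsto (fun m => P (A ∩ {ω | X (T m ω + s) ω = X (T m ω) ω})) Filter.atTop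
      (nhds (P (A ∩ {ω | X (τ ω + s) ω = X (τ ω) ω}))) := by
    refine tendsto_measure_of_tendsto_indicator_of_isFiniteMeasure (μ := P) Filter.atTop
      (fun m => ?_) ?_
    · exact hAmeas.inter (measurableSet_eq_fun
        (measurable_eval_of_isStepPath hX hs ((hT m).add_const s))
        (measurable_eval_of_isStepPath hX hs (hT m)))
    · refine fun ω => ?_
      obtain ⟨u, hu, huv⟩ := (hs ω).persist (τ ω)
      obtain ⟨u', hu', huv'⟩ := (hs ω).persist (τ ω + s)
      have hpos : 0 < min (u - τ ω) (u' - (τ ω + s)) :=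
        lt_min (tsub_pos_of_lt hu) (tsub_pos_of_lt hu')
      obtain ⟨M, hM⟩ := exists_nat_one_div_lt hpos
      filter_upwards [Filter.eventually_ge_atTop M] with m hm
      have hle : T m ω ≤ τ ω + min (u - τ ω) (u' - (τ ω + s)) := by
        refine (hTle m ω).trans ?_
        gcongr
        refine le_trans ?_ hM.le
        gcongr
      have hle1 : T m ω ≤ u := hle.trans <| (add_le_add_right (min_le_left _ _) _).trans
        (add_tsub_cancel_of_le hu.le).le
      have hle2 : T m ω + s ≤ u' := by
        refine (add_le_add_left (hle.trans (add_le_add_right (min_le_right _ _) _)) s).trans ?_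
        rw [add_right_comm, add_tsub_cancel_of_le hu'.le]
      have e1 : X (T m ω) ω = X (τ ω) ω := (hs ω).eq_of_mem_Icc huv.symm (hTgt m ω).le hle1
      have e2 : X (T m ω + s) ω = X (τ ω + s) ω :=
        (hs ω).eq_of_mem_Icc huv'.symm (add_le_add_left (hTgt m ω).le s) hle2
      simp only [Set.mem_inter_iff, Set.mem_ofPred_eq, e1, e2]
  refine tendsto_nhds_unique hlim ?_
  simp only [hgrid]
  exact tendsto_const_nhds

/-! ### Sojourn times of a regular jump process -/

theorem sojournTime_succ_eq {v : ℝ≥0 → ℕ} {k : ℕ} (h : jumpTime v k < ∞) :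
    sojournTime v (k + 1) = jumpTime v (k + 1) - jumpTime v k := by
  simp [sojournTime, h]

theorem measurable_sojournTime_succ {Ω : Type*} [MeasurableSpace Ω] {X : ℝ≥0 → Ω → ℕ}
    (hX : ∀ t, Measurable (X t)) (hs : ∀ ω, IsStepPath fun t => X t ω) (k : ℕ) :
    Measurable fun ω => sojournTime (fun t => X t ω) (k + 1) := by
  have h := measurable_jumpTime hX hs
  simp only [sojournTime, add_tsub_cancel_right]
  exact Measurable.ite (measurableSet_lt (h k) measurable_const) ((h (k + 1)).sub (h k))
    measurable_const

/-- Integer-valued processes all of whose paths start at `0` and are right-continuous and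
nondecreasing, with independent increments, and such that the probability of having no jump in an
interval of length `s` is `exp (-(μ * s))`. The parameter `μ` is the total jump rate; the jump
sizes are arbitrary. -/
structure IsRegularJumpProcess {Ω : Type*} [MeasurableSpace Ω] (X : ℝ≥0 → Ω → ℕ) (μ : ℝ)
    (P : Measure Ω) : Prop where
  measurable : ∀ t, Measurable (X t)
  start_zero : ∀ ω, X 0 ω = 0
  step_path : ∀ ω, IsStepPath fun t => X t ω
  indep_increments : HasIndepIncrements X P
  prob_eq : ∀ t s : ℝ≥0, P {ω | X (t + s) ω = X t ω} = ENNReal.ofReal (Real.exp (-(μ * s)))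

namespace IsRegularJumpProcess

variable {Ω : Type*} [MeasurableSpace Ω] {P : Measure Ω} [IsProbabilityMeasure P]
  {X : ℝ≥0 → Ω → ℕ} {μ : ℝ}

/-- Given the first `k` jump times, the next sojourn time exceeds `s` with probability
`exp (-(μ * s))`. -/
theorem measure_inter_lt_sojournTime (h : IsRegularJumpProcess X μ P) (k : ℕ) (s : ℝ≥0)
    {B : Set (ℕ → ℝ≥0∞)} (hB : MeasurableSet B) :
    P (({ω | (fun i => jumpTime (fun t => X t ω) (min i k)) ∈ B} ∩
        {ω | jumpTime (fun t => X t ω) k < ∞}) ∩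
        {ω | (s : ℝ≥0∞) < sojournTime (fun t => X t ω) (k + 1)}) =
      P ({ω | (fun i => jumpTime (fun t => X t ω) (min i k)) ∈ B} ∩
        {ω | jumpTime (fun t => X t ω) k < ∞}) * ENNReal.ofReal (Real.exp (-(μ * s))) := by
  set A : Set Ω := {ω | (fun i => jumpTime (fun t => X t ω) (min i k)) ∈ B} ∩
    {ω | jumpTime (fun t => X t ω) k < ∞} with hA
  let τ : Ω → ℝ≥0 := fun ω => (jumpTime (fun t => X t ω) k).toNNReal
  let F : ℝ≥0 → MeasurableSpace Ω := fun t =>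
    MeasurableSpace.comap (fun ω (r : ℝ≥0) => X (min r t) ω) inferInstance
  have hFmeas : ∀ t r, Measurable[F t] (X (min r t)) := fun t r =>
    (measurable_pi_apply r).comp (comap_measurable fun ω (r : ℝ≥0) => X (min r t) ω)
  have hFle : ∀ t, F t ≤ ‹MeasurableSpace Ω› := fun t =>
    (measurable_pi_lambda _ fun r => h.measurable _).comap_le
  have hF : Monotone F := by
    intro t u htu
    refine Measurable.comap_le (m₁ := F u) (@measurable_pi_lambda _ _ _ (F u) _ _ fun r => ?_)
    have := hFmeas u (min r t)
    rwa [min_assoc, min_eq_left htu] at this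
  have hset : A ∩ {ω | (s : ℝ≥0∞) < sojournTime (fun t => X t ω) (k + 1)} =
      A ∩ {ω | X (τ ω + s) ω = X (τ ω) ω} := by
    ext ω
    simp only [Set.mem_inter_iff, Set.mem_ofPred_eq]
    refine and_congr_right fun hω => ?_
    have hfin : jumpTime (fun t => X t ω) k < ∞ := hω.2
    have hτ : jumpTime (fun t => X t ω) k = τ ω := (ENNReal.coe_toNNReal hfin.ne).symm
    rw [sojournTime_succ_eq hfin, hτ, lt_tsub_iff_left, ← ENNReal.coe_add]
    exact lt_jumpTime_succ_iff (h.step_path ω) hτ s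
  rw [hset]
  refine measure_inter_eval_add_eq h.measurable h.step_path hF hFle ?_
    (measurable_jumpTime h.measurable h.step_path k).ennreal_toNNReal ?_
  · rintro t E ⟨C, hC, rfl⟩
    have hi := indepFun_stopped_increment h.measurable h.start_zero
      (fun ω => (h.step_path ω).mono) h.indep_increments t s
    have hev : {ω | X (t + s) ω = X t ω} = (fun ω => X (t + s) ω - X t ω) ⁻¹' {0} := by
      ext ω
      have := (h.step_path ω).mono (le_self_add : t ≤ t + s)
      simp only [Set.mem_ofPred_eq, Set.mem_preimage, Set.mem_singleton_iff] at this ⊢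
      omega
    rw [← h.prob_eq t s, hev]
    exact hi.measure_inter_preimage_eq_mul _ _ hC (MeasurableSet.singleton 0)
  · intro t
    -- Before `t`, the jump times are those of the path stopped at `t`.
    have hJ : ∀ i, Measurable[F t] fun ω => jumpTime (fun r => X (min r t) ω) i := fun i =>
      @measurable_jumpTime Ω (F t) (fun r ω => X (min r t) ω) (hFmeas t)
        (fun ω => (h.step_path ω).stopped t) i
    have heq : A ∩ {ω | τ ω < t} =
        (fun ω i => jumpTime (fun r => X (min r t) ω) (min i k)) ⁻¹' B ∩
          {ω | jumpTime (fun r => X (min r t) ω) k < t} := by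
      ext ω
      have hag : ∀ r : ℝ≥0, (r : ℝ≥0∞) < t → X r ω = X (min r t) ω := fun r hr => by
        rw [min_eq_left (ENNReal.coe_lt_coe.1 hr).le]
      have hτ : (jumpTime (fun t => X t ω) k < ∞ ∧ τ ω < t) ↔
          jumpTime (fun t => X t ω) k < t := by
        constructor
        · rintro ⟨h1, h2⟩
          rw [← ENNReal.coe_toNNReal h1.ne]
          exact ENNReal.coe_lt_coe.2 h2
        · intro h1
          have h2 : jumpTime (fun t => X t ω) k < ∞ := h1.trans ENNReal.coe_lt_top
          rw [← ENNReal.coe_toNNReal h2.ne] at h1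
          exact ⟨h2, ENNReal.coe_lt_coe.1 h1⟩
      simp only [hA, Set.mem_inter_iff, Set.mem_ofPred_eq, Set.mem_preimage, and_assoc, hτ]
      constructor
      · rintro ⟨h1, h2⟩
        have hc : ∀ i, jumpTime (fun r => X (min r t) ω) (min i k) =
            jumpTime (fun r => X r ω) (min i k) := fun i =>
          jumpTime_congr_of_lt hag ((jumpTime_mono _ (min_le_right i k)).trans_lt h2)
        have hck := jumpTime_congr_of_lt hag h2
        simp only [hc, hck]
        exact ⟨h1, h2⟩
      · rintro ⟨h1, h2⟩
        have hc : ∀ i, jumpTime (fun r => X r ω) (min i k) =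
            jumpTime (fun r => X (min r t) ω) (min i k) := fun i =>
          jumpTime_congr_of_lt (fun r hr => (hag r hr).symm)
            ((jumpTime_mono _ (min_le_right i k)).trans_lt h2)
        have hck := jumpTime_congr_of_lt (fun r hr => (hag r hr).symm) h2
        simp only [hc, hck]
        exact ⟨h1, h2⟩
    rw [heq]
    exact MeasurableSet.inter ((@measurable_pi_lambda _ _ _ (F t) _ _ fun i => hJ _) hB)
      (hJ k measurableSet_Iio)

/-- By induction: if `J_k < ∞` almost surely, the next sojourn time exceeds `n` with probability
at most `exp (-(μ * n))`, which tends to `0`. -/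
theorem ae_jumpTime_lt_top (h : IsRegularJumpProcess X μ P) (hμ : 0 < μ) (k : ℕ) :
    ∀ᵐ ω ∂P, jumpTime (fun t => X t ω) k < ∞ := by
  induction k with
  | zero => exact Filter.Eventually.of_forall fun ω => by simp [jumpTime]
  | succ k ih =>
    have hle : ∀ n : ℕ, P {ω | ¬ jumpTime (fun t => X t ω) (k + 1) < ∞} ≤
        ENNReal.ofReal (Real.exp (-(μ * n))) := by
      intro n
      have h1 := h.measure_inter_lt_sojournTime k n (B := Set.univ) MeasurableSet.univ
      have h2 : P {ω | ¬ jumpTime (fun t => X t ω) (k + 1) < ∞} ≤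
          P (({ω | (fun i => jumpTime (fun t => X t ω) (min i k)) ∈ Set.univ} ∩
            {ω | jumpTime (fun t => X t ω) k < ∞}) ∩
            {ω | ((n : ℝ≥0) : ℝ≥0∞) < sojournTime (fun t => X t ω) (k + 1)}) := by
        refine measure_mono_ae ?_
        filter_upwards [ih] with ω hω hω'
        refine ⟨⟨trivial, hω⟩, ?_⟩
        have hω'' : jumpTime (fun t => X t ω) (k + 1) = ∞ := not_lt_top_iff.1 hω'
        simp [sojournTime_succ_eq hω, hω'', ENNReal.top_sub hω.ne]
      refine h2.trans (h1.le.trans ?_)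
      exact (mul_le_mul_left prob_le_one _).trans (by simp)
    have hlim : Filter.Tendsto (fun n : ℕ => ENNReal.ofReal (Real.exp (-(μ * n)))) Filter.atTop
        (nhds 0) := by
      rw [← ENNReal.ofReal_zero]
      refine ENNReal.tendsto_ofReal ?_
      exact Real.tendsto_exp_neg_atTop_nhds_zero.comp
        (tendsto_natCast_atTop_atTop.const_mul_atTop hμ)
    exact le_antisymm (ge_of_tendsto' hlim hle) zero_le

theorem ae_sojournTime_lt_top (h : IsRegularJumpProcess X μ P) (hμ : 0 < μ) (k : ℕ) :
    ∀ᵐ ω ∂P, sojournTime (fun t => X t ω) (k + 1) < ∞ := by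
  filter_upwards [h.ae_jumpTime_lt_top hμ k, h.ae_jumpTime_lt_top hμ (k + 1)] with ω h1 h2
  rw [sojournTime_succ_eq h1]
  exact tsub_le_self.trans_lt h2

/-- The form of `measure_inter_lt_sojournTime` without the condition `J_k < ∞`, which holds almost
surely. -/
theorem measure_inter_lt_sojournTime' (h : IsRegularJumpProcess X μ P) (hμ : 0 < μ) (k : ℕ)
    (s : ℝ≥0) {B : Set (ℕ → ℝ≥0∞)} (hB : MeasurableSet B) :
    P ({ω | (fun i => jumpTime (fun t => X t ω) (min i k)) ∈ B} ∩
        {ω | (s : ℝ≥0∞) < sojournTime (fun t => X t ω) (k + 1)}) =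
      P {ω | (fun i => jumpTime (fun t => X t ω) (min i k)) ∈ B} *
        ENNReal.ofReal (Real.exp (-(μ * s))) := by
  have hae : ∀ A : Set Ω, (A ∩ {ω | jumpTime (fun t => X t ω) k < ∞} : Set Ω) =ᵐ[P] A := by
    intro A
    filter_upwards [h.ae_jumpTime_lt_top hμ k] with ω hω
    exact propext (and_iff_left hω)
  rw [← measure_congr (hae {ω | (fun i => jumpTime (fun t => X t ω) (min i k)) ∈ B}),
    ← h.measure_inter_lt_sojournTime k s hB, Set.inter_right_comm]
  exact (measure_congr (hae _)).symm

theorem measure_lt_sojournTime (h : IsRegularJumpProcess X μ P) (hμ : 0 < μ) (k : ℕ) (s : ℝ≥0) :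
    P {ω | (s : ℝ≥0∞) < sojournTime (fun t => X t ω) (k + 1)} =
      ENNReal.ofReal (Real.exp (-(μ * s))) := by
  have := h.measure_inter_lt_sojournTime' hμ k s (B := Set.univ) MeasurableSet.univ
  simpa using this

theorem indepFun_jumpTime_sojournTime (h : IsRegularJumpProcess X μ P) (hμ : 0 < μ) (k : ℕ) :
    IndepFun (fun ω i => jumpTime (fun t => X t ω) (min i k))
      (fun ω => sojournTime (fun t => X t ω) (k + 1)) P := by
  have hJ : Measurable fun ω i => jumpTime (fun t => X t ω) (min i k) :=
    measurable_pi_lambda _ fun i => measurable_jumpTime h.measurable h.step_path _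
  have hS := measurable_sojournTime_succ h.measurable h.step_path k
  refine IndepSets.indep (p1 := {A | MeasurableSet[MeasurableSpace.comap
      (fun ω i => jumpTime (fun t => X t ω) (min i k)) inferInstance] A})
    (p2 := Set.preimage (fun ω => sojournTime (fun t => X t ω) (k + 1)) '' Set.range Set.Ioi)
    hJ.comap_le hS.comap_le ?_ ?_ ?_ ?_ ?_
  · exact @MeasurableSpace.isPiSystem_measurableSet _ (_)
  · rintro _ ⟨_, ⟨a, rfl⟩, rfl⟩ _ ⟨_, ⟨b, rfl⟩, rfl⟩ -
    exact ⟨_, ⟨max a b, rfl⟩, by rw [← Set.preimage_inter, Set.Ioi_inter_Ioi]⟩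
  · exact (@MeasurableSpace.generateFrom_measurableSet _ (_)).symm
  · rw [BorelSpace.measurable_eq (α := ℝ≥0∞), borel_eq_generateFrom_Ioi,
      MeasurableSpace.comap_generateFrom]
  · rw [IndepSets_iff]
    rintro _ _ ⟨B, hB, rfl⟩ ⟨_, ⟨a, rfl⟩, rfl⟩
    induction a with
    | top => simp
    | coe a =>
      have h1 := h.measure_inter_lt_sojournTime' hμ k a hB
      rw [← h.measure_lt_sojournTime hμ k a] at h1
      exact h1

theorem iIndepFun_sojournTime (h : IsRegularJumpProcess X μ P) (hμ : 0 < μ) :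
    iIndepFun (fun (k : ℕ) ω => sojournTime (fun t => X t ω) (k + 1)) P := by
  refine iIndepFun_of_indepFun_past fun k => ?_
  have hφ : Measurable fun (x : ℕ → ℝ≥0∞) (i : Set.Iio k) =>
      if x i < ∞ then x (i + 1) - x i else ∞ :=
    measurable_pi_lambda _ fun i => Measurable.ite
      (measurableSet_lt (measurable_pi_apply _) measurable_const)
      ((measurable_pi_apply _).sub (measurable_pi_apply _)) measurable_const
  convert! (h.indepFun_jumpTime_sojournTime hμ k).comp hφ measurable_id using 1
  funext ω i
  have h1 : (i : ℕ) + 1 ≤ k := i.2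
  simp [sojournTime, Function.comp, min_eq_left h1, min_eq_left (Nat.le_of_succ_le h1)]

theorem hasLaw_sojournTime (h : IsRegularJumpProcess X μ P) (hμ : 0 < μ) (k : ℕ) :
    HasLaw (fun ω => (sojournTime (fun t => X t ω) (k + 1)).toReal) (expMeasure μ) P := by
  have hS := measurable_sojournTime_succ h.measurable h.step_path k
  refine ⟨hS.ennreal_toReal.aemeasurable, ?_⟩
  have := isProbabilityMeasure_expMeasure hμ
  have := Measure.isProbabilityMeasure_map (μ := P) hS.ennreal_toReal.aemeasurable
  refine Measure.eq_of_cdf _ _ ?_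
  ext x
  rw [cdf_expMeasure_eq hμ, cdf_eq_real, map_measureReal_apply hS.ennreal_toReal measurableSet_Iic]
  split_ifs with hx
  · lift x to ℝ≥0 using hx
    have hae : ((fun ω => (sojournTime (fun t => X t ω) (k + 1)).toReal) ⁻¹' Set.Iic (x : ℝ)) =ᵐ[P]
        ({ω | (x : ℝ≥0∞) < sojournTime (fun t => X t ω) (k + 1)}ᶜ : Set Ω) := by
      filter_upwards [h.ae_sojournTime_lt_top hμ k] with ω hω
      refine propext ?_
      change (sojournTime (fun t => X t ω) (k + 1)).toReal ≤ x ↔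
        ¬ (x : ℝ≥0∞) < sojournTime (fun t => X t ω) (k + 1)
      rw [not_lt, ← ENNReal.coe_toReal, ENNReal.toReal_le_toReal hω.ne ENNReal.coe_ne_top]
    rw [measureReal_congr hae, probReal_compl_eq_one_sub (measurableSet_lt measurable_const hS),
      measureReal_def,
      h.measure_lt_sojournTime hμ k x, ENNReal.toReal_ofReal (Real.exp_pos _).le]
  · rw [measureReal_def, Set.eq_empty_of_forall_notMem (s := _ ⁻¹' Set.Iic x), measure_empty,
      ENNReal.toReal_zero]
    intro ω hω
    exact hx (ENNReal.toReal_nonneg.trans hω)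

end IsRegularJumpProcess

/-- An integer-valued process whose properties hold almost surely agrees, almost surely and
simultaneously for all times, with one for which they hold everywhere. -/
theorem exists_isRegularJumpProcess {Ω : Type*} [MeasurableSpace Ω] {P : Measure Ω}
    {X : ℝ≥0 → Ω → ℕ} {μ : ℝ} (hX : ∀ t, Measurable (X t)) (h0 : ∀ᵐ ω ∂P, X 0 ω = 0)
    (hs : ∀ᵐ ω ∂P, IsStepPath fun t => X t ω) (hind : HasIndepIncrements X P)
    (hp : ∀ t s : ℝ≥0, P {ω | X (t + s) ω = X t ω} = ENNReal.ofReal (Real.exp (-(μ * s)))) :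
    ∃ Y, IsRegularJumpProcess Y μ P ∧ ∀ᵐ ω ∂P, ∀ t, Y t ω = X t ω := by
  obtain ⟨B, hB, hBm, hB0⟩ := exists_measurable_superset_of_null (ae_iff.1 (h0.and hs))
  have hgood : ∀ ω ∉ B, X 0 ω = 0 ∧ IsStepPath fun t => X t ω := fun ω hω => by
    by_contra hn
    exact hω (hB hn)
  have hBae : ∀ᵐ ω ∂P, ω ∉ B := measure_eq_zero_iff_ae_notMem.1 hB0
  classical
  let Y : ℝ≥0 → Ω → ℕ := fun t ω => if ω ∈ B then 0 else X t ω
  have hYX : ∀ᵐ ω ∂P, ∀ t, Y t ω = X t ω := by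
    filter_upwards [hBae] with ω hω t
    simp [Y, hω]
  refine ⟨Y, ⟨fun t => Measurable.ite hBm measurable_const (hX t), fun ω => ?_, fun ω => ?_, ?_,
    fun t s => ?_⟩, hYX⟩
  · by_cases hω : ω ∈ B
    · simp [Y, hω]
    · simp [Y, hω, (hgood ω hω).1]
  · by_cases hω : ω ∈ B
    · simpa [Y, hω] using isStepPath_zero
    · simpa [Y, hω] using (hgood ω hω).2
  · intro n t ht
    refine (hind n t ht).congr fun i => ?_
    filter_upwards [hYX] with ω hω
    rw [hω, hω]
  · rw [← hp t s]
    refine measure_congr ?_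
    filter_upwards [hYX] with ω hω
    refine propext ?_
    change Y (t + s) ω = Y t ω ↔ X (t + s) ω = X t ω
    rw [hω, hω]

/-! ### Poisson subordination -/

theorem lintegral_pow_poissonMeasure (r : ℝ≥0) {z : ℝ} (hz : 0 ≤ z) :
    ∫⁻ n, ENNReal.ofReal (z ^ n) ∂(poissonMeasure r) =
      ENNReal.ofReal (Real.exp (-(r * (1 - z)))) := by
  have hsum : HasSum (fun n : ℕ => Real.exp (-r) * (((r : ℝ) * z) ^ n / n.factorial))
      (Real.exp (-r) * Real.exp (r * z)) := by
    refine HasSum.mul_left _ ?_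
    rw [Real.exp_eq_exp_ℝ]
    exact NormedSpace.expSeries_div_hasSum_exp ((r : ℝ) * z)
  rw [poissonMeasure, lintegral_sum_measure]
  simp only [lintegral_smul_measure, lintegral_dirac, smul_eq_mul]
  have hterm : ∀ n : ℕ, ENNReal.ofReal (Real.exp (-r) * r ^ n / n.factorial) *
      ENNReal.ofReal (z ^ n) =
      ENNReal.ofReal (Real.exp (-r) * (((r : ℝ) * z) ^ n / n.factorial)) := fun n => by
    rw [← ENNReal.ofReal_mul (by positivity)]
    congr 1
    rw [mul_pow]
    ring
  simp only [hterm]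
  rw [← ENNReal.ofReal_tsum_of_nonneg (fun n => by positivity) hsum.summable, hsum.tsum_eq,
    ← Real.exp_add]
  congr 2
  ring

/-- An integer-valued subordinator with Laplace-type exponent `g`: a process started at `0` with
nondecreasing right-continuous step paths and independent increments, such that `X t - X s` has
probability generating function `z ↦ exp (-(g z * (t - s)))` on `[0, 1]`. -/
structure IsStepSubordinator {Ω : Type*} [MeasurableSpace Ω] (X : ℝ≥0 → Ω → ℕ) (g : ℝ → ℝ)
    (P : Measure Ω) : Prop where
  measurable : ∀ t, Measurable (X t)
  start_zero : ∀ᵐ ω ∂P, X 0 ω = 0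
  step_path : ∀ᵐ ω ∂P, IsStepPath fun t => X t ω
  indep_increments : HasIndepIncrements X P
  lintegral_pow : ∀ s t : ℝ≥0, s ≤ t → ∀ z ∈ Set.Icc (0 : ℝ) 1,
    ∫⁻ ω, ENNReal.ofReal (z ^ (X t ω - X s ω)) ∂P = ENNReal.ofReal (Real.exp (-(g z * (t - s))))

section

variable {Ω : Type*} [MeasurableSpace Ω] {P : Measure Ω} {X N : ℝ≥0 → Ω → ℕ} {lam : ℝ≥0}
  {g : ℝ → ℝ}

theorem IsPoissonProcess.isStepSubordinator (h : IsPoissonProcess N lam P) :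
    IsStepSubordinator N (fun z => lam * (1 - z)) P where
  measurable := h.measurable
  start_zero := h.start_zero
  step_path := by
    filter_upwards [h.monotone_path, h.right_continuous] with ω h1 h2
    exact IsStepPath.of_rightContinuous h1 h2
  indep_increments := h.indep_increments
  lintegral_pow := by
    intro s t hst z hz
    have hlaw := h.law_increment s t hst
    rw [← lintegral_map' (f := fun n : ℕ => ENNReal.ofReal (z ^ n)) measurable_from_top.aemeasurable
      hlaw.aemeasurable, hlaw.map_eq, lintegral_pow_poissonMeasure _ hz.1]
    push_cast [NNReal.coe_sub hst]
    congr 3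
    ring

/-- Given the inner process `X`, the increments of `N ∘ X` are independent Poisson variables with
means proportional to the increments of `X`. -/
theorem lintegral_prod_increments_comp [IsProbabilityMeasure P] (hX : ∀ t, Measurable (X t))
    (hmono : ∀ᵐ ω ∂P, Monotone fun t => X t ω) (hN : IsPoissonProcess N lam P)
    (hind : IndepFun (fun ω t => X t ω) (fun ω t => N t ω) P) {t : ℕ → ℝ≥0} (ht : Monotone t)
    (S : Finset ℕ) (f : ℕ → ℕ → ℝ≥0∞) :
    ∫⁻ ω, ∏ i ∈ S, f i (N (X (t (i + 1)) ω) ω - N (X (t i) ω) ω) ∂P =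
      ∫⁻ ω, ∏ i ∈ S, (∫⁻ n, f i n ∂(poissonMeasure
        (lam * ((X (t (i + 1)) ω - X (t i) ω : ℕ) : ℝ≥0)))) ∂P := by
  let U : Ω → ℕ → ℕ := fun ω i => X (t i) ω
  let W : Ω → ℝ≥0 → ℕ := fun ω r => N r ω
  have hU : Measurable U := measurable_pi_lambda _ fun i => hX _
  have hW : Measurable W := measurable_pi_lambda _ hN.measurable
  have hUW : IndepFun U W P := hind.comp
    (measurable_pi_lambda (fun (x : ℝ≥0 → ℕ) (i : ℕ) => x (t i)) fun i => measurable_pi_apply _)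
    measurable_id
  let G : (ℕ → ℕ) × (ℝ≥0 → ℕ) → ℝ≥0∞ := fun p =>
    ∏ i ∈ S, f i (p.2 (p.1 (i + 1)) - p.2 (p.1 i))
  have hev : ∀ i, Measurable fun p : (ℕ → ℕ) × (ℝ≥0 → ℕ) => p.2 (p.1 i) := by
    intro i
    have h1 : Measurable fun q : ℕ × (ℝ≥0 → ℕ) => q.2 (q.1 : ℝ≥0) :=
      measurable_from_prod_countable_right fun n => measurable_pi_apply (n : ℝ≥0)
    have h2 : Measurable fun p : (ℕ → ℕ) × (ℝ≥0 → ℕ) => (p.1 i, p.2) := by fun_prop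
    exact h1.comp h2
  have hG : Measurable G := Finset.measurable_prod _ fun i _ =>
    measurable_from_top.comp ((hev (i + 1)).sub (hev i))
  have h1 : ∫⁻ ω, G (U ω, W ω) ∂P = ∫⁻ ω, ∫⁻ ω', G (U ω, W ω') ∂P ∂P := by
    have hmap := (indepFun_iff_map_prod_eq_prod_map_map hU.aemeasurable hW.aemeasurable).1 hUW
    have := Measure.isProbabilityMeasure_map (μ := P) hW.aemeasurable
    rw [← lintegral_map hG (hU.prodMk hW), hmap, lintegral_prod _ hG.aemeasurable,
      lintegral_map hG.lintegral_prod_right' hU]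
    refine lintegral_congr fun ω => ?_
    exact lintegral_map (f := fun y => G (U ω, y)) (hG.comp measurable_prodMk_left) hW
  refine h1.trans (lintegral_congr_ae ?_)
  filter_upwards [hmono] with ω hω
  have hτ : Monotone fun i => (X (t i) ω : ℝ≥0) := fun i j hij => Nat.cast_le.2 (hω (ht hij))
  have hinc := (hN.indep_increments.nat hτ).comp (fun i => f i) fun i => measurable_from_top
  refine (lintegral_prod_eq_prod_lintegral_of_indepFun S _ hinc fun i =>
    measurable_from_top.comp ((hN.measurable _).sub (hN.measurable _))).trans ?_
  refine Finset.prod_congr rfl fun i _ => ?_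
  have hlaw := hN.law_increment _ _ (hτ (Nat.le_succ i))
  simp only [Nat.succ_eq_add_one] at hlaw
  rw [Nat.cast_tsub, ← hlaw.map_eq,
    lintegral_map' measurable_from_top.aemeasurable hlaw.aemeasurable]
  rfl

/-- Running a Poisson process along an independent integer-valued subordinator gives an
integer-valued subordinator; the exponents compose. -/
theorem IsStepSubordinator.comp_poisson [IsProbabilityMeasure P] (hX : IsStepSubordinator X g P)
    (hN : IsPoissonProcess N lam P)
    (hind : IndepFun (fun ω t => X t ω) (fun ω t => N t ω) P) :
    IsStepSubordinator (fun t ω => N (X t ω) ω) (fun z => g (Real.exp (-(lam * (1 - z))))) P := by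
  have hmono : ∀ᵐ ω ∂P, Monotone fun t => X t ω := hX.step_path.mono fun ω h => h.mono
  have hY : ∀ t, Measurable fun ω => N (X t ω) ω := by
    intro t
    have h1 : Measurable fun p : ℕ × Ω => N (p.1 : ℝ≥0) p.2 :=
      measurable_from_prod_countable_right fun n => hN.measurable (n : ℝ≥0)
    exact h1.comp ((hX.measurable t).prodMk measurable_id)
  have hprod := fun {t : ℕ → ℝ≥0} (ht : Monotone t) S f =>
    lintegral_prod_increments_comp hX.measurable hmono hN hind ht S f
  refine ⟨hY, ?_, ?_, ?_, ?_⟩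
  · filter_upwards [hX.start_zero, hN.start_zero] with ω h1 h2
    simp [h1, h2]
  · filter_upwards [hX.step_path, hN.monotone_path] with ω h1 h2
    exact h1.comp h2
  · refine HasIndepIncrements.of_nat fun t ht _ => ?_
    rw [iIndepFun_iff_measure_inter_preimage_eq_mul]
    intro S sets _
    classical
    have hinc : ∀ i, Measurable fun ω => N (X (t (i + 1)) ω) ω - N (X (t i) ω) ω := fun i =>
      (hY _).sub (hY _)
    -- With `f i` the indicator of `sets i`, the mixed Poisson formula factorizes because the
    -- increments of the inner process are independent.
    let f : ℕ → ℕ → ℝ≥0∞ := fun i => (sets i).indicator 1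
    let κ : ℕ → ℕ → ℝ≥0∞ := fun i d => ∫⁻ n, f i n ∂(poissonMeasure (lam * (d : ℝ≥0)))
    have hfac : ∀ S : Finset ℕ,
        ∫⁻ ω, ∏ i ∈ S, f i (N (X (t (i + 1)) ω) ω - N (X (t i) ω) ω) ∂P =
          ∏ i ∈ S, ∫⁻ ω, κ i (X (t (i + 1)) ω - X (t i) ω) ∂P := by
      intro S
      rw [hprod ht]
      exact lintegral_prod_eq_prod_lintegral_of_indepFun S
        (fun i ω => κ i (X (t (i + 1)) ω - X (t i) ω))
        ((hX.indep_increments.nat ht).comp κ fun i => measurable_from_top) fun i =>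
        (measurable_from_top (f := κ i)).comp
          ((hX.measurable (t (i + 1))).sub (hX.measurable (t i)))
    have hmeas : ∀ S : Finset ℕ,
        P (⋂ i ∈ S, (fun ω => N (X (t (i + 1)) ω) ω - N (X (t i) ω) ω) ⁻¹' sets i) =
          ∫⁻ ω, ∏ i ∈ S, f i (N (X (t (i + 1)) ω) ω - N (X (t i) ω) ω) ∂P := by
      intro S
      rw [← lintegral_indicator_one (Finset.measurableSet_biInter S fun i _ =>
        hinc i (MeasurableSet.of_discrete))]
      refine lintegral_congr fun ω => ?_
      simp only [f, Set.indicator_apply, Pi.one_apply, Set.mem_iInter, Set.mem_preimage]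
      rw [Finset.prod_ite_zero]
      simp
    rw [hmeas, hfac]
    refine Finset.prod_congr rfl fun i _ => ?_
    have := hmeas {i}
    rw [hfac] at this
    simpa using this.symm
  · intro s t hst z hz
    let τ : ℕ → ℝ≥0 := fun i => if i = 0 then s else t
    have hτ : Monotone τ := monotone_nat_of_le_succ fun i => by
      by_cases hi : i = 0 <;> simp [τ, hi, hst]
    have h1 := hprod hτ {0} fun _ n => ENNReal.ofReal (z ^ n)
    simp only [Finset.prod_singleton, τ, zero_add, one_ne_zero, if_true, if_false] at h1
    rw [h1]
    simp only [lintegral_pow_poissonMeasure _ hz.1]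
    have hψ : Real.exp (-(lam * (1 - z))) ∈ Set.Icc (0 : ℝ) 1 :=
      ⟨(Real.exp_pos _).le, Real.exp_le_one_iff.2 (neg_nonpos.2
        (mul_nonneg lam.2 (sub_nonneg.2 hz.2)))⟩
    rw [← hX.lintegral_pow s t hst _ hψ]
    refine lintegral_congr fun ω => ?_
    rw [← Real.exp_nat_mul]
    congr 2
    simp only [NNReal.coe_mul, NNReal.coe_natCast]
    ring

/-- The no-jump probability is the value of the generating function at `0`, as `0 ^ 0 = 1`. -/
theorem IsStepSubordinator.measure_eq (hX : IsStepSubordinator X g P) {s t : ℝ≥0} (hst : s ≤ t) :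
    P {ω | X t ω = X s ω} = ENNReal.ofReal (Real.exp (-(g 0 * (t - s)))) := by
  rw [← hX.lintegral_pow s t hst 0 (by simp), ← lintegral_indicator_one
    (measurableSet_eq_fun (hX.measurable _) (hX.measurable _))]
  refine lintegral_congr_ae ?_
  filter_upwards [hX.step_path] with ω hω
  have hle : X s ω ≤ X t ω := hω.mono hst
  by_cases h : X t ω = X s ω
  · simp [h]
  · have : X t ω - X s ω ≠ 0 := by omega
    simp [h, this]

theorem IsStepSubordinator.measureReal_pos_one [IsProbabilityMeasure P]
    (hX : IsStepSubordinator X g P) : P.real {ω | 0 < X 1 ω} = 1 - Real.exp (-g 0) := by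
  have h1 := hX.measure_eq (zero_le : (0 : ℝ≥0) ≤ 1)
  have h2 : ({ω | 0 < X 1 ω} : Set Ω) =ᵐ[P] ({ω | X 1 ω = X 0 ω}ᶜ : Set Ω) := by
    filter_upwards [hX.start_zero] with ω hω
    refine propext ?_
    change 0 < X 1 ω ↔ ¬ X 1 ω = X 0 ω
    omega
  rw [measureReal_congr h2, probReal_compl_eq_one_sub
    (measurableSet_eq_fun (hX.measurable _) (hX.measurable _)), measureReal_def, h1,
    ENNReal.toReal_ofReal (Real.exp_pos _).le]
  simp

end

/-! ### Iterated Poisson processes -/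

/-- The value `V^(m)_t` is a measurable function of the processes `N 1, …, N m`. -/
theorem measurable_iteratedProcess {Ω : Type*} {mΩ : MeasurableSpace Ω} {N : ℕ → ℝ≥0 → Ω → ℕ}
    (m : ℕ) (hN : ∀ i, 1 ≤ i → i ≤ m → ∀ t, Measurable (N i t)) (t : ℝ≥0) :
    Measurable (iteratedProcess N m t) := by
  induction m with
  | zero => exact measurable_const
  | succ m ih =>
    cases m with
    | zero => exact hN 1 le_rfl le_rfl t
    | succ m =>
      have h1 : Measurable fun p : ℕ × Ω => N (m + 2) (p.1 : ℝ≥0) p.2 :=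
        measurable_from_prod_countable_right fun n => hN (m + 2) (by omega) le_rfl (n : ℝ≥0)
      exact h1.comp ((ih fun i h1 h2 => hN i h1 (by omega)).prodMk measurable_id)

section Iterated

variable {Ω : Type*} [MeasurableSpace Ω] {P : Measure Ω} {lam : ℝ≥0} {n : ℕ}
  {N : ℕ → ℝ≥0 → Ω → ℕ}

theorem indepFun_iteratedProcess_succ (hN : ∀ i ∈ Finset.Icc 1 n, ∀ t, Measurable (N i t))
    (hindep : iIndepFun (fun (i : Finset.Icc 1 n) (ω : Ω) (t : ℝ≥0) => N i t ω) P)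
    {m : ℕ} (hm : m + 1 ≤ n) :
    IndepFun (fun ω t => iteratedProcess N m t ω) (fun ω t => N (m + 1) t ω) P := by
  let M : Finset.Icc 1 n → MeasurableSpace Ω := fun i =>
    MeasurableSpace.comap (fun ω (t : ℝ≥0) => N i t ω) inferInstance
  have hle : ∀ i, M i ≤ ‹MeasurableSpace Ω› := fun i =>
    (measurable_pi_lambda _ fun t => hN i i.2 t).comap_le
  have hdisj : Disjoint {i : Finset.Icc 1 n | (i : ℕ) ≤ m} {i | (i : ℕ) = m + 1} :=
    Set.disjoint_left.2 fun i (h1 : (i : ℕ) ≤ m) (h2 : (i : ℕ) = m + 1) => by omega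
  have hI := indep_iSup_of_disjoint hle hindep.iIndep hdisj
  refine indep_of_indep_of_le hI ?_ ?_
  · refine Measurable.comap_le (@measurable_pi_lambda _ _ _ (_) _ _ fun t => ?_)
    refine measurable_iteratedProcess (mΩ := _) m (fun i h1 h2 r => ?_) t
    have hi : i ∈ Finset.Icc 1 n := Finset.mem_Icc.2 ⟨h1, by omega⟩
    have h3 : Measurable[M ⟨i, hi⟩] (N i r) :=
      (measurable_pi_apply r).comp (comap_measurable fun ω (t : ℝ≥0) => N i t ω)
    exact h3.mono (le_iSup₂_of_le (⟨i, hi⟩ : Finset.Icc 1 n) h2 le_rfl) le_rfl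
  · have hi : m + 1 ∈ Finset.Icc 1 n := Finset.mem_Icc.2 ⟨by omega, hm⟩
    exact le_iSup₂_of_le (f := fun (i : Finset.Icc 1 n) (_ : i ∈ {i : Finset.Icc 1 n |
      (i : ℕ) = m + 1}) => M i) (⟨m + 1, hi⟩ : Finset.Icc 1 n) rfl le_rfl

theorem isStepSubordinator_iteratedProcess [IsProbabilityMeasure P]
    (hN : ∀ i ∈ Finset.Icc 1 n, IsPoissonProcess (N i) lam P)
    (hindep : iIndepFun (fun (i : Finset.Icc 1 n) (ω : Ω) (t : ℝ≥0) => N i t ω) P)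
    (m : ℕ) (hm : m + 1 ≤ n) :
    IsStepSubordinator (iteratedProcess N (m + 1))
      (fun z => lam * (1 - (fun z => Real.exp (-(lam * (1 - z))))^[m] z)) P := by
  induction m with
  | zero => exact (hN 1 (Finset.mem_Icc.2 ⟨le_rfl, hm⟩)).isStepSubordinator
  | succ m ih =>
    exact (ih (by omega)).comp_poisson (hN (m + 2) (Finset.mem_Icc.2 ⟨by omega, hm⟩))
      (indepFun_iteratedProcess_succ (fun i hi => (hN i hi).measurable) hindep hm)

theorem positiveProb_eq [IsProbabilityMeasure P]
    (hN : ∀ i ∈ Finset.Icc 1 n, IsPoissonProcess (N i) lam P)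
    (hindep : iIndepFun (fun (i : Finset.Icc 1 n) (ω : Ω) (t : ℝ≥0) => N i t ω) P)
    (m : ℕ) (hm : m + 1 ≤ n) :
    positiveProb P N (m + 1) = 1 - (fun z => Real.exp (-(lam * (1 - z))))^[m + 1] 0 := by
  rw [positiveProb, (isStepSubordinator_iteratedProcess hN hindep m hm).measureReal_pos_one,
    Function.iterate_succ_apply']

end Iterated

theorem proposition2p2 {Ω : Type*} [MeasurableSpace Ω] (P : Measure Ω) [IsProbabilityMeasure P]
    (lam : ℝ≥0) (hlam : 0 < lam) (n : ℕ) (hn : 2 ≤ n) (N : ℕ → ℝ≥0 → Ω → ℕ)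
    (hN : ∀ i ∈ Finset.Icc 1 n, IsPoissonProcess (N i) lam P)
    (hindep : iIndepFun (fun (i : Finset.Icc 1 n) (ω : Ω) (t : ℝ≥0) => N i t ω) P) :
    -- the sojourn times `S_1, S_2, …` of `V^(n)` are independent,
    iIndepFun (fun (k : ℕ) (ω : Ω) =>
        sojournTime (fun t => iteratedProcess N n t ω) (k + 1)) P ∧
    -- almost surely finite, and exponential with rate `lam * q_{n-1}`;
    (∀ k : ℕ, 1 ≤ k →
      (∀ᵐ ω ∂P, sojournTime (fun t => iteratedProcess N n t ω) k < ∞) ∧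
      HasLaw (fun ω => (sojournTime (fun t => iteratedProcess N n t ω) k).toReal)
        (expMeasure (lam * positiveProb P N (n - 1))) P) ∧
    -- initial value and recursion for `q_j`.
    positiveProb P N 1 = 1 - Real.exp (-(lam : ℝ)) ∧
    (∀ j : ℕ, 2 ≤ j → j ≤ n →
      positiveProb P N j = 1 - Real.exp (-((lam : ℝ) * positiveProb P N (j - 1)))) := by
  have hq := positiveProb_eq hN hindep
  have hrec : ∀ m, m + 2 ≤ n → positiveProb P N (m + 2) =
      1 - Real.exp (-((lam : ℝ) * positiveProb P N (m + 1))) := by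
    intro m hm
    rw [hq (m + 1) hm, hq m (by omega), Function.iterate_succ_apply']
  have hq1 : positiveProb P N 1 = 1 - Real.exp (-(lam : ℝ)) := by
    rw [hq 0 (by omega)]
    simp
  have hqpos : ∀ m, m + 1 ≤ n → 0 < positiveProb P N (m + 1) := by
    intro m
    induction m with
    | zero =>
      intro _
      rw [hq1, sub_pos, Real.exp_lt_one_iff, neg_lt_zero]
      exact_mod_cast hlam
    | succ m ih =>
      intro hm
      rw [hrec m hm, sub_pos, Real.exp_lt_one_iff, neg_lt_zero]
      exact mul_pos (by exact_mod_cast hlam) (ih (by omega))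
  obtain ⟨m, rfl⟩ : ∃ m, n = m + 2 := ⟨n - 2, by omega⟩
  have hV := isStepSubordinator_iteratedProcess hN hindep (m + 1) le_rfl
  have hrate : 0 < (lam : ℝ) * positiveProb P N (m + 1) :=
    mul_pos (by exact_mod_cast hlam) (hqpos m (by omega))
  obtain ⟨Y, hY, hYV⟩ := exists_isRegularJumpProcess (μ := lam * positiveProb P N (m + 1))
    hV.measurable hV.start_zero hV.step_path hV.indep_increments fun t s => by
      rw [hV.measure_eq le_self_add, hq m (by omega)]
      push_cast
      rw [add_sub_cancel_left]
  have hS : ∀ k, (fun ω => sojournTime (fun t => Y t ω) k) =ᵐ[P]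
      fun ω => sojournTime (fun t => iteratedProcess N (m + 2) t ω) k := by
    intro k
    filter_upwards [hYV] with ω hω
    simp only [hω]
  refine ⟨(hY.iIndepFun_sojournTime hrate).congr fun k => hS (k + 1), ?_, hq1, ?_⟩
  · intro k hk
    obtain ⟨k, rfl⟩ : ∃ j, k = j + 1 := ⟨k - 1, by omega⟩
    constructor
    · filter_upwards [hY.ae_sojournTime_lt_top hrate k, hS (k + 1)] with ω h1 h2
      exact h2 ▸ h1
    · refine (hY.hasLaw_sojournTime hrate k).congr ?_
      filter_upwards [hS (k + 1)] with ω hω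
      rw [hω]
  · intro j hj hjn
    obtain ⟨j, rfl⟩ : ∃ i, j = i + 2 := ⟨j - 2, by omega⟩
    exact hrec j hjn
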